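/- **Conventions.** A propositional language $\mathcal L$ is a set of connectives with arities in $\{0,1,2,\dots\}$. $\mathrm{Fm}_{\mathcal L}$ is the algebra of $\mathcal L$-formulas over a fixed denumerable set $\mathrm{Var}=\{x_1,x_2,\dots\}$ of variables, common to all languages. $\Sigma_{\mathcal L}$ is the monoid, under composition, of the endomorphisms of $\mathrm{Fm}_{\mathcal L}$ (the substitutions). A sequent of type $(m,n)\neq(0,0)$ is a pair consisting of a sequence of $m$ formulas and a sequence of $n$ formulas; $\Sigma_{\mathcal L}$ acts on sequents componentwise. A *propositional deductive system* $\langle S,\vdash\rangle$ on $\mathcal L$ consists of a set $S$ of sequents containing, with any sequent, all sequents of the same type, and of a relation ${\vdash}\subseteq\wp(S)\times S$ such that for all $X,Y\subseteq S$, $u\in S$: $X\vdash u$ if $u\in X$; $X\vdash u$ and $X\subseteq Y$ imply $Y\vdash u$; $Y\vdash u$ and $X\vdash v$ for all $v\in Y$ imply $X\vdash u$; and $X\vdash u$ implies $\sigma\cdot X\vdash\sigma\cdot u$ for all $\sigma\in\Sigma_{\mathcal L}$. We write $X\vdash Y$ if $X\vdash v$ for all $v\in Y$, and $\gamma(X)=\{u\in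 S: X\vdash u\}$ for the associated consequence operator. **Translations and interpretations.** A *language translation* of $\mathcal L$ into $\mathcal L'$ is a map $\tau:\mathrm{Fm}_{\mathcal L}\to\mathrm{Fm}_{\mathcal L'}$ such that $\tau^{-1}(x)=\{x\}$ for every variable $x$, and such that for each connective $f$ of $\mathcal L$, of arity $n$, there is an $\mathcal L'$-formula $\varphi_f$ whose variables are exactly $x_1,\dots,x_n$ with $\tau(f(\phi_1,\dots,\phi_n))=\varphi_f[x_1/\tau(\phi_1),\dots,x_n/\tau(\phi_n)]$ for all $\phi_1,\dots,\phi_n\in\mathrm{Fm}_{\mathcal L}$. It induces the monoid homomorphism $\overline\tau:\Sigma_{\mathcal L}\to\Sigma_{\mathcal L'}$ for which $\overline\tau(\sigma)(x)=\tau(\sigma(x))$ for every variable $x$. Let $\mathcal S=\langle S,\vdash_S\rangle$ and $\mathcal T=\langle T,\vdash_T\rangle$ be deductive systems on $\mathcal L$ and $\mathcal L'$. $\mathcal S$ is *interpretable* (resp. *representable*) in $\mathcal T$ if there are a language translation $\tau$ of $\mathcal L$ into $\mathcal L'$ and a map $\iota:S\to\wp(T)$ such that $\iota(\sigma\cdot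 u)=\overline\tau(\sigma)\cdot\iota(u)$ for all $\sigma\in\Sigma_{\mathcal L}$, $u\in S$, and such that, for all $X\cup\{u\}\subseteq S$, $X\vdash_S u$ implies (resp. holds if and only if) $\bigcup_{x\in X}\iota(x)\vdash_T\iota(u)$. **Quantales and modules.** For a monoid $A$, $\wp(A)$ is a unital quantale under unions and the elementwise product. $\wp(S)_\gamma=\{X\subseteq S:\gamma(X)=X\}$ is a left $\wp(\Sigma_{\mathcal L})$-module, with joins $\gamma(\bigcup_i X_i)$ and scalar multiplication $\Sigma\cdot_\gamma X=\gamma(\{\sigma\cdot x:\sigma\in\Sigma,\ x\in X\})$. Homomorphisms of quantales preserve arbitrary joins, products and the unit; homomorphisms of modules preserve arbitrary joins and scalar multiplication. If $h:Q\to R$ is a quantale homomorphism and $N$ an $R$-module, $N_h$ is the $Q$-module with the same underlying complete lattice and $a\cdot_h x=h(a)\cdot x$. An element $p$ of a complete lattice is *completely join-prime* if $p\le\bigvee X$ implies $p\le x$ for some $x\in X$. A *quantale translation* is a quantale homomorphism $h:\wp(\Sigma_{\mathcal L})\to\wp(\Sigma_{\mathcal L'})$ such that 1. $h$ maps completely join-prime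 elements to completely join-prime elements; 2. if $\Sigma'\in\wp(\Sigma_{\mathcal L'})$ is completely join-prime and multiplicatively idempotent, then every completely join-prime element of $h^{-1}(\Sigma')$ is multiplicatively idempotent; 3. $h^{-1}(\Sigma)=\{\Sigma\}$ for every set $\Sigma$ of substitutions that map variables to variables, where such substitutions, being determined by maps $\mathrm{Var}\to\mathrm{Var}$, are identified in $\Sigma_{\mathcal L}$ and in $\Sigma_{\mathcal L'}$. **Theorem.** Let $\mathcal S=\langle S,\vdash_\gamma\rangle$ and $\mathcal T=\langle T,\vdash_\delta\rangle$ be propositional deductive systems on the languages $\mathcal L$ and $\mathcal L'$, with consequence operators $\gamma$ and $\delta$. Then $\mathcal S$ is interpretable (respectively: representable) in $\mathcal T$ if and only if there exist a quantale translation $h:\wp(\Sigma_{\mathcal L})\to\wp(\Sigma_{\mathcal L'})$ and a homomorphism (respectively: an injective homomorphism) of $\wp(\Sigma_{\mathcal L})$-modules $f:\wp(S)_\gamma\to(\wp(T)_\delta)_h$. -/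

import Mathlib

open scoped Pointwise

universe u v w w'

namespace DedSys

/-! ### Consequence relations on sets with a monoid action -/

/-- A consequence relation over `S`: a relation between subsets and elements of `S` that is
reflexive, monotone and closed under cut. -/
structure ConsequenceRelation (S : Type u) where
  Entails : Set S → S → Prop
  of_mem : ∀ (X : Set S) (x : S), x ∈ X → Entails X x
  mono : ∀ (X Y : Set S) (x : S), Entails X x → X ⊆ Y → Entails Y x
  cut : ∀ (X Y : Set S) (x : S), Entails Y x → (∀ y ∈ Y, Entails X y) → Entails X x

namespace ConsequenceRelation

/-- `X ⊢ Y`, that is, `X ⊢ y` for every `y ∈ Y`. -/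
def EntailsSet {S : Type u} (C : ConsequenceRelation S) (X Y : Set S) : Prop :=
  ∀ y ∈ Y, C.Entails X y

/-- `X ⊢ x` implies `a • X ⊢ a • x`, where `a • X = {a • y | y ∈ X}`. -/
def ActionInvariant {S : Type u} (C : ConsequenceRelation S) (A : Type v) [Monoid A]
    [MulAction A S] : Prop :=
  ∀ (a : A) (X : Set S) (x : S), C.Entails X x → C.Entails (a • X) (a • x)

end ConsequenceRelation

/-- The image `ι[X] = ⋃ x ∈ X, ι x` of a set `X` under a map `ι : S → ℘(T)`. -/
def extendToSets {S : Type u} {T : Type v} (ι : S → Set T) (X : Set S) : Set T :=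
  ⋃ x ∈ X, ι x

/-- `ι` is action-invariant via the monoid homomorphism `h`. -/
def ActionInvariantVia {A : Type u} {B : Type v} [Monoid A] [Monoid B] {S : Type w}
    {T : Type w'} [MulAction A S] [MulAction B T] (h : A →* B) (ι : S → Set T) : Prop :=
  ∀ (a : A) (x : S), ι (a • x) = h a • ι x

/-- `ι` is an interpretation, via the monoid homomorphism `h`, of the consequence relation `C`
in the consequence relation `D`. -/
def IsInterpretationVia {A : Type u} {B : Type v} [Monoid A] [Monoid B] {S : Type w}
    {T : Type w'} [MulAction A S] [MulAction B T] (h : A →* B) (C : ConsequenceRelation S)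
    (D : ConsequenceRelation T) (ι : S → Set T) : Prop :=
  ActionInvariantVia h ι ∧
    ∀ (X : Set S) (x : S), C.Entails X x → D.EntailsSet (extendToSets ι X) (ι x)

/-- `ι` is a representation (conservative interpretation), via the monoid homomorphism `h`, of
the consequence relation `C` in the consequence relation `D`. -/
def IsRepresentationVia {A : Type u} {B : Type v} [Monoid A] [Monoid B] {S : Type w}
    {T : Type w'} [MulAction A S] [MulAction B T] (h : A →* B) (C : ConsequenceRelation S)
    (D : ConsequenceRelation T) (ι : S → Set T) : Prop :=
  ActionInvariantVia h ι ∧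
    ∀ (X : Set S) (x : S), C.Entails X x ↔ D.EntailsSet (extendToSets ι X) (ι x)

/-! ### Propositional languages, formulas, substitutions -/

/-- A propositional language: a set of connectives with their arities. -/
structure PropLanguage where
  Conn : Type u
  arity : Conn → ℕ

/-- The formulas of a propositional language over the denumerable set `{x_n | n : ℕ}` of
variables. -/
inductive Formula (L : PropLanguage.{u}) : Type u
  | var : ℕ → Formula L
  | app : (f : L.Conn) → (Fin (L.arity f) → Formula L) → Formula L

namespace Formula

variable {L : PropLanguage.{u}}

/-- The set of (indices of) variables that occur in a formula. -/
def vars : Formula L → Set ℕ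
  | var n => {n}
  | app _ φ => ⋃ i, (φ i).vars

/-- Simultaneous replacement of every variable `x_n` by the formula `ρ n`. -/
def subst (ρ : ℕ → Formula L) : Formula L → Formula L
  | var n => ρ n
  | app f φ => app f (fun i => (φ i).subst ρ)

end Formula

/-- The monoid of substitutions: the endomorphisms of the algebra of formulas, under
composition. It acts on formulas by evaluation. -/
def Subst (L : PropLanguage.{u}) : Submonoid (Function.End (Formula L)) where
  carrier := {σ | ∀ (f : L.Conn) (φ : Fin (L.arity f) → Formula L),
    σ (Formula.app f φ) = Formula.app f (fun i => σ (φ i))}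
  one_mem' := fun _ _ => rfl
  mul_mem' := by
    intro σ ρ hσ hρ f φ
    change σ (ρ (Formula.app f φ)) = _
    rw [hρ, hσ]
    rfl

namespace Subst

variable {L : PropLanguage.{u}}

theorem smul_app (σ : Subst L) (f : L.Conn) (φ : Fin (L.arity f) → Formula L) :
    σ • Formula.app f φ = Formula.app f (fun i => σ • φ i) :=
  σ.2 f φ

/-- The substitution determined by its values on the variables. -/
def ofVars (ρ : ℕ → Formula L) : Subst L :=
  ⟨fun φ => φ.subst ρ, fun _ _ => rfl⟩

@[simp] theorem ofVars_smul (ρ : ℕ → Formula L) (φ : Formula L) :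
    ofVars ρ • φ = φ.subst ρ := rfl

theorem ext_vars {σ ρ : Subst L}
    (h : ∀ n, σ • (Formula.var n : Formula L) = ρ • (Formula.var n : Formula L)) : σ = ρ := by
  apply Subtype.ext
  funext φ
  change σ • φ = ρ • φ
  induction φ with
  | var n => exact h n
  | app f φ ih => rw [smul_app, smul_app]; congr 1; funext i; exact ih i

theorem smul_subst (σ : Subst L) (ρ : ℕ → Formula L) (φ : Formula L) :
    σ • φ.subst ρ = φ.subst (fun n => σ • ρ n) := by
  induction φ with
  | var n => rfl
  | app f φ ih =>
    rw [Formula.subst, smul_app, Formula.subst]; congr 1; funext i; exact ih i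

/-- The substitution `x_n ↦ x_{r n}`. The substitutions of this form are exactly those that map
variables to variables; letting the same `r` act in two languages identifies the two
corresponding monoids. -/
def rename (L : PropLanguage.{u}) (r : ℕ → ℕ) : Subst L :=
  ofVars (fun n => Formula.var (r n))

end Subst

theorem Formula.subst_congr {L : PropLanguage.{u}} {ρ ρ' : ℕ → Formula L} {φ : Formula L}
    (h : ∀ n ∈ φ.vars, ρ n = ρ' n) : φ.subst ρ = φ.subst ρ' := by
  induction φ with
  | var n => exact h n rfl
  | app f φ ih =>
    simp only [Formula.subst]
    congr 1; funext i
    exact ih i (fun n hn => h n (Set.mem_iUnion.2 ⟨i, hn⟩))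

/-! ### Sequents and deductive systems -/

/-- Sequents `φ_1, …, φ_m ⇒ ψ_1, …, ψ_n`, where `m` and `n` are not both zero. -/
structure Sequent (L : PropLanguage.{u}) where
  left : List (Formula L)
  right : List (Formula L)
  nonempty : (left.length, right.length) ≠ (0, 0)

namespace Sequent

variable {L : PropLanguage.{u}}

/-- The type `(m, n)` of a sequent. -/
def type (s : Sequent L) : ℕ × ℕ := (s.left.length, s.right.length)

theorem ext' {s t : Sequent L} (h₁ : s.left = t.left) (h₂ : s.right = t.right) : s = t := by
  cases s; cases t; cases h₁; cases h₂; rfl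

instance : MulAction (Subst L) (Sequent L) where
  smul σ s :=
    { left := s.left.map (fun φ => σ • φ)
      right := s.right.map (fun φ => σ • φ)
      nonempty := by simpa only [List.length_map] using s.nonempty }
  one_smul s := ext' (List.map_id' _) (List.map_id' _)
  mul_smul σ ρ s := by
    apply ext'
    · change List.map _ _ = List.map _ (List.map _ _)
      rw [List.map_map]; rfl
    · change List.map _ _ = List.map _ (List.map _ _)
      rw [List.map_map]; rfl

theorem type_smul (σ : Subst L) (s : Sequent L) : (σ • s).type = s.type := by
  change ((List.map _ _).length, (List.map _ _).length) = _
  rw [List.length_map, List.length_map]; rfl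

end Sequent

/-- A set of sequents closed under type: with a sequent it contains all sequents of that type. -/
structure SequentSet (L : PropLanguage.{u}) where
  carrier : Set (Sequent L)
  closed_type : ∀ s ∈ carrier, ∀ t : Sequent L, t.type = s.type → t ∈ carrier

namespace SequentSet

variable {L : PropLanguage.{u}}

/-- The members of a set of sequents, as a type. -/
def Elem (S : SequentSet L) : Type u := {s : Sequent L // s ∈ S.carrier}

instance (S : SequentSet L) : MulAction (Subst L) S.Elem where
  smul σ s := ⟨σ • s.1, S.closed_type s.1 s.2 _ (Sequent.type_smul σ s.1)⟩
  one_smul s := Subtype.ext (one_smul _ s.1)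
  mul_smul σ ρ s := Subtype.ext (mul_smul σ ρ s.1)

end SequentSet

/-- A propositional deductive system over `L`: a set of sequents with a substitution-invariant
consequence relation. -/
structure DeductiveSystem (L : PropLanguage.{u}) where
  sequents : SequentSet L
  conseq : ConsequenceRelation sequents.Elem
  substInvariant : conseq.ActionInvariant (Subst L)

/-! ### Language translations -/

/-- `g` is a derived operation on formulas: it is given by substitution in a formula `φ` in the
`n` variables `x_0, …, x_{n-1}`, all of which occur in `φ`. -/
def IsDerivedOp {L : PropLanguage.{u}} {n : ℕ} (g : (Fin n → Formula L) → Formula L) : Prop :=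
  ∃ φ : Formula L, φ.vars = {k | k < n} ∧
    ∀ ψ : Fin n → Formula L,
      g ψ = φ.subst (fun k => if hk : k < n then ψ ⟨k, hk⟩ else Formula.var k)

/-- `τ` is a language translation of `L` into `L'`. -/
def IsTranslation {L : PropLanguage.{u}} {L' : PropLanguage.{v}}
    (τ : Formula L → Formula L') : Prop :=
  ∃ op : (f : L.Conn) → (Fin (L.arity f) → Formula L') → Formula L',
    (∀ f, IsDerivedOp (op f)) ∧
    (∀ n, τ ⁻¹' {Formula.var n} = {Formula.var n}) ∧
    ∀ (f : L.Conn) (φ : Fin (L.arity f) → Formula L),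
      τ (Formula.app f φ) = op f (fun i => τ (φ i))

section Induced

variable {L : PropLanguage.{u}} {L' : PropLanguage.{v}} {τ : Formula L → Formula L'}

theorem IsTranslation.map_var (hτ : IsTranslation τ) (n : ℕ) :
    τ (Formula.var n) = Formula.var n := by
  obtain ⟨op, -, h, -⟩ := hτ
  have : (Formula.var n : Formula L) ∈ τ ⁻¹' {Formula.var n} := by rw [h]; rfl
  exact this

theorem IsTranslation.map_smul (hτ : IsTranslation τ) (σ : Subst L) (φ : Formula L) :
    τ (σ • φ) = (τ φ).subst (fun n => τ (σ • (Formula.var n : Formula L))) := by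
  induction φ with
  | var n => rw [hτ.map_var]; rfl
  | app f φ ih =>
    obtain ⟨op, hop, -, h⟩ := hτ
    obtain ⟨χ, hχ, hg⟩ := hop f
    rw [Subst.smul_app, h, h, hg, hg]
    change _ = (Subst.ofVars (fun n => τ (σ • (Formula.var n : Formula L))) : Subst L') •
      Formula.subst _ χ
    rw [Subst.smul_subst]
    apply Formula.subst_congr
    intro n hn
    have hn' : n < L.arity f := by rw [hχ] at hn; exact hn
    simp only [hn', dif_pos]
    exact ih _

/-- The homomorphism of substitution monoids induced by a language translation `τ`: it sends
`σ` to the substitution with `x ↦ τ (σ x)` for every variable `x`. -/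
def IsTranslation.induced (hτ : IsTranslation τ) : Subst L →* Subst L' where
  toFun σ := Subst.ofVars (fun n => τ (σ • (Formula.var n : Formula L)))
  map_one' := Subst.ext_vars (fun n => by
    rw [Subst.ofVars_smul, one_smul, Formula.subst, one_smul, hτ.map_var])
  map_mul' σ ρ := Subst.ext_vars (fun n => by
    rw [mul_smul, Subst.ofVars_smul, Subst.ofVars_smul, Subst.ofVars_smul]
    simp only [Formula.subst]
    rw [mul_smul]
    exact hτ.map_smul σ _)

end Induced

/-- `S` is interpretable in `T`: there are a language translation `τ` and an interpretation of
`S` in `T` via the homomorphism of substitution monoids induced by `τ`. -/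
def DeductiveSystem.InterpretableIn {L : PropLanguage.{u}} {L' : PropLanguage.{v}}
    (S : DeductiveSystem L) (T : DeductiveSystem L') : Prop :=
  ∃ (τ : Formula L → Formula L') (hτ : IsTranslation τ)
    (ι : S.sequents.Elem → Set T.sequents.Elem),
    IsInterpretationVia hτ.induced S.conseq T.conseq ι

/-- `S` is representable in `T`: there are a language translation `τ` and a representation of
`S` in `T` via the homomorphism of substitution monoids induced by `τ`. -/
def DeductiveSystem.RepresentableIn {L : PropLanguage.{u}} {L' : PropLanguage.{v}}
    (S : DeductiveSystem L) (T : DeductiveSystem L') : Prop :=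
  ∃ (τ : Formula L → Formula L') (hτ : IsTranslation τ)
    (ι : S.sequents.Elem → Set T.sequents.Elem),
    IsRepresentationVia hτ.induced S.conseq T.conseq ι

/-! ### Quantales and quantale modules

A (unital) quantale is a complete lattice and monoid `Q` with Mathlib's `IsQuantale Q`. -/

/-- A homomorphism of unital quantales: a monoid homomorphism that preserves arbitrary joins. -/
structure QuantaleHom (Q : Type u) (R : Type v) [Monoid Q] [CompleteLattice Q] [Monoid R]
    [CompleteLattice R] extends Q →* R where
  map_sSup' : ∀ A : Set Q, toFun (sSup A) = sSup (toFun '' A)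

instance {Q : Type u} {R : Type v} [Monoid Q] [CompleteLattice Q] [Monoid R]
    [CompleteLattice R] : CoeFun (QuantaleHom Q R) (fun _ => Q → R) :=
  ⟨fun h => h.toFun⟩

/-- A left module over a quantale `Q`: a complete lattice with an action of the monoid `Q` that
distributes over arbitrary joins in both arguments. -/
class IsQuantaleModule (Q : Type u) (M : Type v) [Monoid Q] [CompleteLattice Q] [IsQuantale Q]
    [CompleteLattice M] [MulAction Q M] : Prop where
  smul_sSup : ∀ (a : Q) (X : Set M), a • sSup X = sSup ((fun x => a • x) '' X)
  sSup_smul : ∀ (A : Set Q) (x : M), sSup A • x = sSup ((fun a => a • x) '' A)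

/-- A homomorphism of `Q`-modules: it preserves arbitrary joins and scalar multiplication. -/
structure QuantaleModuleHom (Q : Type u) (M : Type v) (N : Type w) [Monoid Q]
    [CompleteLattice Q] [IsQuantale Q] [CompleteLattice M] [MulAction Q M]
    [IsQuantaleModule Q M] [CompleteLattice N] [MulAction Q N] [IsQuantaleModule Q N] where
  toFun : M → N
  map_sSup' : ∀ X : Set M, toFun (sSup X) = sSup (toFun '' X)
  map_smul' : ∀ (a : Q) (x : M), toFun (a • x) = a • toFun x

/-- The powerset of a monoid, with union and elementwise product, is a quantale. -/
instance powersetQuantale (A : Type u) [Monoid A] : IsQuantale (Set A) where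
  mul_sSup_distrib := Set.mul_sUnion
  sSup_mul_distrib := Set.sUnion_mul

/-- The powerset of an `A`-set, with union and elementwise action, is a module over the powerset
of the monoid `A`. -/
instance powersetModule (A : Type u) (S : Type v) [Monoid A] [MulAction A S] :
    IsQuantaleModule (Set A) (Set S) where
  smul_sSup a X := by rw [sSup_image]; exact Set.smul_sUnion a X
  sSup_smul A x := by rw [sSup_image]; exact Set.sUnion_smul A x

/-- A nucleus on a `Q`-module: a closure operator `γ` with `a • γ x ≤ γ (a • x)`. -/
structure ModuleNucleus (Q : Type u) (M : Type v) [Monoid Q] [CompleteLattice Q] [IsQuantale Q]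
    [CompleteLattice M] [MulAction Q M] [IsQuantaleModule Q M] extends ClosureOperator M where
  smul_le : ∀ (a : Q) (x : M), a • toFun x ≤ toFun (a • x)

section NucleusModule

variable {Q : Type u} {M : Type v} [Monoid Q] [CompleteLattice Q] [IsQuantale Q]
  [CompleteLattice M] [MulAction Q M] [IsQuantaleModule Q M]

theorem IsQuantaleModule.smul_le_smul (a : Q) {x y : M} (h : x ≤ y) : a • x ≤ a • y := by
  have h1 := IsQuantaleModule.smul_sSup a ({x, y} : Set M)
  rw [sSup_pair, sup_eq_right.2 h, Set.image_pair, sSup_pair] at h1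
  exact sup_eq_right.1 h1.symm

/-- The module `M_γ` of the closed elements of a nucleus `γ`, with the order of `M`, joins
`γ (⋁ X)` and scalar multiplication `γ (a • x)`. -/
def ModuleNucleus.Closed (γ : ModuleNucleus Q M) : Type v := γ.toClosureOperator.Closeds

/-- The element `γ x` of `M_γ`. -/
def ModuleNucleus.close (γ : ModuleNucleus Q M) (x : M) : γ.Closed :=
  γ.toClosureOperator.toCloseds x

instance (γ : ModuleNucleus Q M) : CompleteLattice γ.Closed :=
  γ.toClosureOperator.gi.liftCompleteLattice

theorem ModuleNucleus.sSup_def (γ : ModuleNucleus Q M) (X : Set γ.Closed) :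
    sSup X = γ.close (sSup ((fun x : γ.Closed => x.1) '' X)) := rfl

theorem ModuleNucleus.closure_coe (γ : ModuleNucleus Q M) (x : γ.Closed) :
    γ.toClosureOperator x.1 = x.1 := x.2.closure_eq

theorem ModuleNucleus.close_coe (γ : ModuleNucleus Q M) (x : γ.Closed) :
    γ.close x.1 = x := Subtype.ext (γ.closure_coe x)

theorem ModuleNucleus.close_le_iff (γ : ModuleNucleus Q M) {x : M} {y : γ.Closed} :
    γ.close x ≤ y ↔ x ≤ y.1 := γ.toClosureOperator.gi.gc x y

theorem ModuleNucleus.le_close (γ : ModuleNucleus Q M) (x : M) : x ≤ (γ.close x).1 :=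
  γ.toClosureOperator.le_closure x

theorem ModuleNucleus.close_mono (γ : ModuleNucleus Q M) {x y : M} (h : x ≤ y) :
    γ.close x ≤ γ.close y := γ.toClosureOperator.gi.gc.monotone_l h

theorem ModuleNucleus.close_smul_close (γ : ModuleNucleus Q M) (a : Q) (x : M) :
    γ.close (a • (γ.close x).1) = γ.close (a • x) := by
  apply le_antisymm
  · exact γ.close_le_iff.2 (γ.smul_le a x)
  · exact γ.close_mono (IsQuantaleModule.smul_le_smul a (γ.le_close x))

instance (γ : ModuleNucleus Q M) : MulAction Q γ.Closed where
  smul a x := γ.close (a • x.1)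
  one_smul x := by
    change γ.close ((1 : Q) • x.1) = x
    rw [one_smul, γ.close_coe]
  mul_smul a b x := by
    change γ.close ((a * b) • x.1) = γ.close (a • (γ.close (b • x.1)).1)
    rw [γ.close_smul_close, mul_smul]

theorem ModuleNucleus.smul_def (γ : ModuleNucleus Q M) (a : Q) (x : γ.Closed) :
    a • x = γ.close (a • x.1) := rfl

theorem ModuleNucleus.sSup_image_close {α : Type w} (γ : ModuleNucleus Q M) (g : α → M)
    (X : Set α) :
    sSup ((fun x => γ.close (g x)) '' X) = γ.close (sSup (g '' X)) := by
  apply le_antisymm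
  · apply sSup_le
    rintro _ ⟨x, hx, rfl⟩
    exact γ.close_mono (le_sSup ⟨x, hx, rfl⟩)
  · apply γ.close_le_iff.2
    apply sSup_le
    rintro _ ⟨x, hx, rfl⟩
    exact γ.close_le_iff.1 (le_sSup ⟨x, hx, rfl⟩)

instance (γ : ModuleNucleus Q M) : IsQuantaleModule Q γ.Closed where
  smul_sSup a X := by
    simp only [ModuleNucleus.smul_def]
    rw [γ.sSup_image_close, γ.sSup_def, γ.close_smul_close, IsQuantaleModule.smul_sSup,
      Set.image_image]
  sSup_smul A x := by
    simp only [ModuleNucleus.smul_def]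
    rw [γ.sSup_image_close, IsQuantaleModule.sSup_smul]

end NucleusModule

section RestrictScalars

variable {Q : Type u} {R : Type v} [Monoid Q] [CompleteLattice Q] [IsQuantale Q] [Monoid R]
  [CompleteLattice R] [IsQuantale R]

/-- The `Q`-module `N_h` obtained from an `R`-module `N` by restricting scalars along a quantale
homomorphism `h : Q → R`: the same complete lattice, with `a • x := h a • x`. -/
def RestrictAlong (_h : QuantaleHom Q R) (N : Type w) : Type w := N

variable (h : QuantaleHom Q R) (N : Type w) [CompleteLattice N] [MulAction R N]

instance : CompleteLattice (RestrictAlong h N) := inferInstanceAs (CompleteLattice N)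

instance : MulAction Q (RestrictAlong h N) := MulAction.compHom N h.toMonoidHom

instance [IsQuantaleModule R N] : IsQuantaleModule Q (RestrictAlong h N) where
  smul_sSup a X := IsQuantaleModule.smul_sSup (M := N) (h a) X
  sSup_smul A x := by
    have h1 := IsQuantaleModule.sSup_smul (M := N) (h '' A) x
    rw [← h.map_sSup', Set.image_image] at h1
    exact h1

end RestrictScalars

/-- The consequence operator `X ↦ {u | X ⊢ u}` of an action-invariant consequence relation, as a
nucleus on the powerset module. -/
def ConsequenceRelation.nucleus {S : Type u} (C : ConsequenceRelation S) {A : Type v} [Monoid A]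
    [MulAction A S] (hC : C.ActionInvariant A) : ModuleNucleus (Set A) (Set S) where
  toClosureOperator := ClosureOperator.mk' (fun X => {x | C.Entails X x})
    (fun _ _ hXY _ hx => C.mono _ _ _ hx hXY)
    (fun _ _ hx => C.of_mem _ _ hx)
    (fun X _ hx => C.cut X _ _ hx (fun _ hy => hy))
  smul_le := by
    rintro B X _ ⟨b, hb, x, hx, rfl⟩
    refine C.mono (b • X) (B • X) _ (hC b X x hx) ?_
    rintro _ ⟨y, hy, rfl⟩
    exact ⟨b, hb, y, hy, rfl⟩

/-- The `℘(Σ_L)`-module `℘(S)_γ` of the theories of a deductive system. -/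
abbrev DeductiveSystem.TheoryModule {L : PropLanguage.{u}} (S : DeductiveSystem L) : Type u :=
  (S.conseq.nucleus S.substInvariant).Closed

/-! ### Quantale translations -/

/-- `p` is completely join-prime: whenever `p` lies below a join of a set, it lies below a member
of the set. -/
def IsCompletelyJoinPrime {M : Type u} [CompleteLattice M] (p : M) : Prop :=
  ∀ X : Set M, p ≤ sSup X → ∃ x ∈ X, p ≤ x

/-- A quantale homomorphism `h : ℘(Σ_L) → ℘(Σ_L')` is a (quantale) translation if
* it preserves completely join-prime elements;
* completely join-prime elements with a completely join-prime idempotent image are idempotent;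
* `h⁻¹(V) = {V}` for each set `V` of substitutions mapping variables to variables, where these
  substitutions are identified in `Σ_L` and in `Σ_L'`. -/
structure IsQuantaleTranslation {L : PropLanguage.{u}} {L' : PropLanguage.{v}}
    (h : QuantaleHom (Set (Subst L)) (Set (Subst L'))) : Prop where
  joinPrime : ∀ A, IsCompletelyJoinPrime A → IsCompletelyJoinPrime (h A)
  idempotent : ∀ B, IsCompletelyJoinPrime B → IsIdempotentElem B →
    ∀ A, IsCompletelyJoinPrime A → h A = B → IsIdempotentElem A
  renamings : ∀ r : Set (ℕ → ℕ),
    h ⁻¹' {Subst.rename L' '' r} = {Subst.rename L '' r}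

end DedSys

/-! The theorem separates into a statement about scalars and one about modules.

Scalars. The completely join-prime elements of a powerset are the singletons, so a quantale
translation `h` restricts on singletons to a monoid homomorphism `k` of substitutions. Its other two
conditions say that `k` reflects idempotents and that `k σ` is a given renaming exactly when `σ` is
that renaming. Such `k` are precisely the homomorphisms induced by language translations. A formula
`φ` is encoded by the constant substitution with value `φ`, and `τ φ` is read off as the value of `k
(const φ)` at a variable. Since `σ * const φ = const (σ • φ)`, this `τ` is equivariant, hence given
on each connective `f` by substitution in the image of `f(x_0, …, x_{n-1})`. Renamings show that `τ`
adds no variables, idempotents that it loses none. Conversely, idempotency of `σ` depends only on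
which variables occur in each `σ x_n` and on which variables `σ` fixes, and a translation preserves
and reflects both.

Modules. An interpretation `ι` yields the homomorphism sending a theory `X` to the theory generated
by `ι[X]`. Conversely, `f` has to be lifted to an equivariant map on sequents. This is possible
because every sequent is a substitution instance of the generic sequent of its type, and the
instantiating substitution can be chosen equivariantly. Conservativity corresponds to injectivity
because an injective join-preserving map reflects the order. -/

namespace DedSys

/-! ### Interpretations induce module homomorphisms -/

/-- The direct image map of a monoid homomorphism, as a homomorphism of powerset quantales. -/
def QuantaleHom.ofMonoidHom {A : Type u} {B : Type v} [Monoid A] [Monoid B] (k : A →* B) :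
    QuantaleHom (Set A) (Set B) where
  toFun X := k '' X
  map_one' := by rw [Set.image_one, map_one, Set.singleton_one]
  map_mul' X Y := Set.image_mul k
  map_sSup' 𝒳 := Set.image_sUnion

theorem QuantaleHom.ofMonoidHom_apply {A : Type u} {B : Type v} [Monoid A] [Monoid B]
    (k : A →* B) (X : Set A) : ofMonoidHom k X = k '' X := rfl

theorem mem_extendToSets {S : Type u} {T : Type v} {ι : S → Set T} {X : Set S} {t : T} :
    t ∈ extendToSets ι X ↔ ∃ x ∈ X, t ∈ ι x := by
  simp [extendToSets]

theorem extendToSets_sSup {S : Type u} {T : Type v} (ι : S → Set T) (𝒳 : Set (Set S)) :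
    extendToSets ι (sSup 𝒳) = sSup (extendToSets ι '' 𝒳) := by
  ext t
  simp only [mem_extendToSets, Set.sSup_eq_sUnion, Set.mem_sUnion, Set.mem_image]
  constructor
  · rintro ⟨x, ⟨X, hX, hx⟩, ht⟩
    exact ⟨_, ⟨X, hX, rfl⟩, mem_extendToSets.2 ⟨x, hx, ht⟩⟩
  · rintro ⟨_, ⟨X, hX, rfl⟩, ht⟩
    obtain ⟨x, hx, ht⟩ := mem_extendToSets.1 ht
    exact ⟨x, ⟨X, hX, hx⟩, ht⟩

section Nucleus

variable {A : Type u} {B : Type v} [Monoid A] [Monoid B] {S : Type w} {T : Type w'}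
  [MulAction A S] [MulAction B T] {C : ConsequenceRelation S} {D : ConsequenceRelation T}

theorem ConsequenceRelation.close_singleton_le_iff (hC : C.ActionInvariant A) {X : Set S}
    {x : S} : (C.nucleus hC).close {x} ≤ (C.nucleus hC).close X ↔ C.Entails X x := by
  rw [ModuleNucleus.close_le_iff]
  exact Set.singleton_subset_iff

theorem ConsequenceRelation.close_le_close_iff (hC : C.ActionInvariant A) {X Y : Set S} :
    (C.nucleus hC).close Y ≤ (C.nucleus hC).close X ↔ C.EntailsSet X Y := by
  rw [ModuleNucleus.close_le_iff]
  exact Iff.rfl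

variable {k : A →* B} {ι : S → Set T}

theorem ActionInvariantVia.extendToSets_smul (hι : ActionInvariantVia k ι) (a : Set A)
    (X : Set S) : extendToSets ι (a • X) = (k '' a) • extendToSets ι X := by
  ext t
  simp only [mem_extendToSets, Set.mem_smul, Set.mem_image]
  constructor
  · rintro ⟨_, ⟨b, hb, x, hx, rfl⟩, ht⟩
    rw [hι] at ht
    obtain ⟨s, hs, rfl⟩ := ht
    exact ⟨_, ⟨b, hb, rfl⟩, s, ⟨x, hx, hs⟩, rfl⟩
  · rintro ⟨_, ⟨b, hb, rfl⟩, s, ⟨x, hx, hs⟩, rfl⟩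
    refine ⟨_, ⟨b, hb, x, hx, rfl⟩, ?_⟩
    rw [hι]
    exact Set.smul_mem_smul_set hs

/-- Soundness puts `ι x` in the theory of `ι[X]` whenever `X ⊢ x`, so closing `X` first adds
nothing. Joins and scalar multiples of theories are closures, so this is what lets the induced map
preserve them. -/
theorem IsInterpretationVia.close_extendToSets_close (hι : IsInterpretationVia k C D ι)
    (hC : C.ActionInvariant A) (hD : D.ActionInvariant B) (X : Set S) :
    (D.nucleus hD).close (extendToSets ι ((C.nucleus hC).close X).1) =
      (D.nucleus hD).close (extendToSets ι X) := by
  apply le_antisymm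
  · rw [D.close_le_close_iff]
    intro t ht
    obtain ⟨x, hx, ht⟩ := mem_extendToSets.1 ht
    exact hι.2 X x hx t ht
  · exact (D.nucleus hD).close_mono
      (Set.biUnion_mono ((C.nucleus hC).le_close X) fun _ _ => le_rfl)

/-- The homomorphism of modules of theories induced by an interpretation: it sends a theory `X`
to the theory generated by `ι[X]`. -/
noncomputable def IsInterpretationVia.moduleHom (hι : IsInterpretationVia k C D ι)
    (hC : C.ActionInvariant A) (hD : D.ActionInvariant B) :
    QuantaleModuleHom (Set A) (C.nucleus hC).Closed
      (RestrictAlong (QuantaleHom.ofMonoidHom k) (D.nucleus hD).Closed) where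
  toFun X := (D.nucleus hD).close (extendToSets ι X.1)
  map_sSup' 𝒳 := by
    change _ = sSup ((fun X : (C.nucleus hC).Closed =>
      (D.nucleus hD).close (extendToSets ι X.1)) '' 𝒳)
    rw [ModuleNucleus.sSup_image_close, ModuleNucleus.sSup_def, hι.close_extendToSets_close,
      extendToSets_sSup, Set.image_image]
  map_smul' a X := by
    change _ = (k '' a) • (D.nucleus hD).close (extendToSets ι X.1)
    rw [ModuleNucleus.smul_def, ModuleNucleus.smul_def, hι.close_extendToSets_close,
      ModuleNucleus.close_smul_close, hι.1.extendToSets_smul]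

theorem IsRepresentationVia.isInterpretationVia (hι : IsRepresentationVia k C D ι) :
    IsInterpretationVia k C D ι :=
  ⟨hι.1, fun X x => (hι.2 X x).1⟩

theorem IsRepresentationVia.moduleHom_injective (hι : IsRepresentationVia k C D ι)
    (hC : C.ActionInvariant A) (hD : D.ActionInvariant B) :
    Function.Injective (hι.isInterpretationVia.moduleHom hC hD).toFun := by
  have key : ∀ X Y : (C.nucleus hC).Closed,
      (D.nucleus hD).close (extendToSets ι X.1) ≤ (D.nucleus hD).close (extendToSets ι Y.1) →
      X ≤ Y := by
    intro X Y h
    rw [D.close_le_close_iff] at h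
    rw [← (C.nucleus hC).close_coe X, ← (C.nucleus hC).close_coe Y, C.close_le_close_iff]
    intro x hx
    exact (hι.2 Y.1 x).2 fun t ht => h t (mem_extendToSets.2 ⟨x, hx, ht⟩)
  exact fun X Y h => le_antisymm (key X Y (le_of_eq h)) (key Y X (le_of_eq h.symm))

/-! ### Module homomorphisms induced by a map of generators -/

theorem QuantaleModuleHom.monotone {Q : Type u} {M : Type v} {N : Type w} [Monoid Q]
    [CompleteLattice Q] [IsQuantale Q] [CompleteLattice M] [MulAction Q M]
    [IsQuantaleModule Q M] [CompleteLattice N] [MulAction Q N] [IsQuantaleModule Q N]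
    (f : QuantaleModuleHom Q M N) : Monotone f.toFun := by
  intro x y h
  have h1 := f.map_sSup' {x, y}
  rw [sSup_pair, sup_eq_right.2 h, Set.image_pair, sSup_pair] at h1
  exact sup_eq_right.1 h1.symm

/-- If `f x ≤ f y`, then `f (x ⊔ y) = f x ⊔ f y = f y`, and injectivity gives `x ⊔ y = y`. -/
theorem QuantaleModuleHom.le_of_injective {Q : Type u} {M : Type v} {N : Type w} [Monoid Q]
    [CompleteLattice Q] [IsQuantale Q] [CompleteLattice M] [MulAction Q M]
    [IsQuantaleModule Q M] [CompleteLattice N] [MulAction Q N] [IsQuantaleModule Q N]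
    {f : QuantaleModuleHom Q M N} (hf : Function.Injective f.toFun) {x y : M}
    (h : f.toFun x ≤ f.toFun y) : x ≤ y := by
  have h1 := f.map_sSup' {x, y}
  rw [sSup_pair, Set.image_pair, sSup_pair, sup_eq_right.2 h] at h1
  exact sup_eq_right.1 (hf h1)

/-- `ι` lifts `f` to generators: the theory generated by `ι x` is the image under `f` of the
theory generated by `x`. -/
def IsLift {h : QuantaleHom (Set A) (Set B)} (hC : C.ActionInvariant A)
    (hD : D.ActionInvariant B)
    (f : QuantaleModuleHom (Set A) (C.nucleus hC).Closed
      (RestrictAlong h (D.nucleus hD).Closed)) (ι : S → Set T) : Prop :=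
  ∀ x, f.toFun ((C.nucleus hC).close {x}) = (D.nucleus hD).close (ι x)

variable {h : QuantaleHom (Set A) (Set B)} {hC : C.ActionInvariant A}
  {hD : D.ActionInvariant B}
  {f : QuantaleModuleHom (Set A) (C.nucleus hC).Closed (RestrictAlong h (D.nucleus hD).Closed)}

/-- A theory is the join of the theories generated by the single elements of a generating set, and
`f` preserves joins. -/
theorem IsLift.map_close (hι : IsLift hC hD f ι) (X : Set S) :
    f.toFun ((C.nucleus hC).close X) = (D.nucleus hD).close (extendToSets ι X) := by
  have h1 := f.map_sSup' ((fun x => (C.nucleus hC).close {x}) '' X)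
  rw [ModuleNucleus.sSup_image_close, Set.image_image] at h1
  have h2 : sSup ((fun x : S => ({x} : Set S)) '' X) = X := by
    rw [sSup_image]; exact Set.biUnion_of_singleton X
  have h3 : (fun x => f.toFun ((C.nucleus hC).close {x})) =
      fun x => (D.nucleus hD).close (ι x) := funext hι
  rw [h2, h3] at h1
  refine h1.trans (((D.nucleus hD).sSup_image_close ι X).trans ?_)
  rw [sSup_image]
  rfl

theorem IsLift.entailsSet (hι : IsLift hC hD f ι) {X : Set S} {x : S} (hx : C.Entails X x) :
    D.EntailsSet (extendToSets ι X) (ι x) := by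
  rw [← D.close_le_close_iff hD, ← hι x, ← hι.map_close]
  exact f.monotone ((C.close_singleton_le_iff hC).2 hx)

theorem IsLift.entails_of_injective (hι : IsLift hC hD f ι) (hf : Function.Injective f.toFun)
    {X : Set S} {x : S} (hx : D.EntailsSet (extendToSets ι X) (ι x)) : C.Entails X x := by
  rw [← D.close_le_close_iff hD, ← hι x, ← hι.map_close] at hx
  exact (C.close_singleton_le_iff hC).1 (QuantaleModuleHom.le_of_injective hf hx)

end Nucleus

/-! ### Completely join-prime elements of powersets -/

theorem isCompletelyJoinPrime_set_iff {α : Type u} {X : Set α} :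
    IsCompletelyJoinPrime X ↔ ∃ x, X = {x} := by
  constructor
  · intro hX
    -- Join-primeness is tested on the decomposition of `X` into its singletons.
    obtain ⟨_, ⟨x, hx, rfl⟩, h⟩ := hX ((fun x => {x}) '' X)
      (by rw [sSup_image]; exact (Set.biUnion_of_singleton X).ge)
    exact ⟨x, Set.Subset.antisymm h (Set.singleton_subset_iff.2 hx)⟩
  · rintro ⟨x, rfl⟩ 𝒳 h
    obtain ⟨X, hX, hx⟩ := h rfl
    exact ⟨X, hX, Set.singleton_subset_iff.2 hx⟩

theorem isIdempotentElem_singleton_iff {A : Type u} [Monoid A] {a : A} :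
    IsIdempotentElem ({a} : Set A) ↔ IsIdempotentElem a := by
  rw [IsIdempotentElem, Set.singleton_mul_singleton, Set.singleton_eq_singleton_iff,
    IsIdempotentElem]

/-! ### Substitutions -/

theorem Formula.subst_var {L : PropLanguage.{u}} (φ : Formula L) : φ.subst Formula.var = φ := by
  induction φ with
  | var n => rfl
  | app f φ ih => simp only [Formula.subst, ih]

theorem Formula.subst_eq_subst_iff {L : PropLanguage.{u}} {ρ ρ' : ℕ → Formula L}
    {φ : Formula L} : φ.subst ρ = φ.subst ρ' ↔ ∀ n ∈ φ.vars, ρ n = ρ' n := by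
  refine ⟨fun h => ?_, Formula.subst_congr⟩
  induction φ with
  | var n =>
    rintro _ rfl
    exact h
  | app f φ ih =>
    intro n hn
    obtain ⟨i, hi⟩ := Set.mem_iUnion.1 hn
    simp only [Formula.subst, Formula.app.injEq, heq_eq_eq, true_and] at h
    exact ih i (congrFun h i) n hi

theorem Formula.vars_subst {L : PropLanguage.{u}} (ρ : ℕ → Formula L) (φ : Formula L) :
    (φ.subst ρ).vars = ⋃ n ∈ φ.vars, (ρ n).vars := by
  induction φ with
  | var n => simp [Formula.subst, Formula.vars]
  | app f φ ih =>
    simp only [Formula.subst, Formula.vars, ih]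
    ext m
    simp only [Set.mem_iUnion]
    constructor
    · rintro ⟨i, n, hn, hm⟩
      exact ⟨n, ⟨i, hn⟩, hm⟩
    · rintro ⟨n, ⟨i, hn⟩, hm⟩
      exact ⟨i, n, hn, hm⟩

namespace Subst

variable {L : PropLanguage.{u}}

theorem smul_eq_subst (σ : Subst L) (φ : Formula L) :
    σ • φ = φ.subst (fun n => σ • (Formula.var n : Formula L)) := by
  rw [← smul_subst, Formula.subst_var]

theorem ofVars_smul_var (ρ : ℕ → Formula L) (n : ℕ) :
    ofVars ρ • (Formula.var n : Formula L) = ρ n := rfl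

theorem rename_smul_var (r : ℕ → ℕ) (n : ℕ) :
    rename L r • (Formula.var n : Formula L) = Formula.var (r n) := rfl

theorem mul_ofVars (σ : Subst L) (ρ : ℕ → Formula L) :
    σ * ofVars ρ = ofVars (fun n => σ • ρ n) :=
  ext_vars fun n => by rw [mul_smul]; rfl

/-- A substitution fixes a formula iff it fixes every variable occurring in it; apply this to the
formulas `σ x_n`. -/
theorem isIdempotentElem_iff {σ : Subst L} :
    IsIdempotentElem σ ↔ ∀ n, ∀ m ∈ (σ • (Formula.var n : Formula L)).vars,
      σ • (Formula.var m : Formula L) = Formula.var m := by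
  have key : ∀ φ : Formula L,
      σ • φ = φ ↔ ∀ m ∈ φ.vars, σ • (Formula.var m : Formula L) = Formula.var m := by
    intro φ
    rw [← Formula.subst_eq_subst_iff, Formula.subst_var, ← smul_eq_subst]
  simp only [← key]
  constructor
  · intro h n
    rw [← mul_smul, h.eq]
  · intro h
    exact ext_vars fun n => by rw [mul_smul, h]

end Subst

/-! ### The quantale translation of a language translation -/

section Translation

variable {L : PropLanguage.{u}} {L' : PropLanguage.{v}} {τ : Formula L → Formula L'}

theorem IsTranslation.eq_var (hτ : IsTranslation τ) {φ : Formula L} {n : ℕ}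
    (h : τ φ = Formula.var n) : φ = Formula.var n := by
  obtain ⟨op, -, hv, -⟩ := hτ
  have h1 : φ ∈ τ ⁻¹' {Formula.var n} := h
  rw [hv] at h1
  exact h1

/-- The formula defining a derived operation contains all of its `n` variables and no others, so no
argument is dropped and the default branch contributes nothing. -/
theorem IsTranslation.vars_map (hτ : IsTranslation τ) (φ : Formula L) :
    (τ φ).vars = φ.vars := by
  induction φ with
  | var n => rw [hτ.map_var]; rfl
  | app f φ ih =>
    obtain ⟨op, hop, -, h⟩ := hτ
    obtain ⟨χ, hχ, hg⟩ := hop f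
    rw [h, hg, Formula.vars_subst, hχ, Formula.vars]
    ext m
    simp only [Set.mem_iUnion, Set.mem_ofPred_eq, ← ih]
    constructor
    · rintro ⟨n, hn, hm⟩
      rw [dif_pos hn] at hm
      exact ⟨_, hm⟩
    · rintro ⟨i, hm⟩
      exact ⟨i, i.2, by rwa [dif_pos i.2]⟩

theorem IsTranslation.induced_smul_var (hτ : IsTranslation τ) (σ : Subst L) (n : ℕ) :
    hτ.induced σ • (Formula.var n : Formula L') = τ (σ • (Formula.var n : Formula L)) := rfl

theorem IsTranslation.induced_eq_rename_iff (hτ : IsTranslation τ) {σ : Subst L} {r : ℕ → ℕ} :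
    hτ.induced σ = Subst.rename L' r ↔ σ = Subst.rename L r := by
  constructor
  · intro h
    refine Subst.ext_vars fun n => hτ.eq_var ?_
    rw [← hτ.induced_smul_var, h, Subst.rename_smul_var]
  · rintro rfl
    refine Subst.ext_vars fun n => ?_
    rw [hτ.induced_smul_var, Subst.rename_smul_var, hτ.map_var, Subst.rename_smul_var]

theorem IsTranslation.isIdempotentElem_of_induced (hτ : IsTranslation τ) {σ : Subst L}
    (h : IsIdempotentElem (hτ.induced σ)) : IsIdempotentElem σ := by
  rw [Subst.isIdempotentElem_iff] at h ⊢
  intro n m hm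
  refine hτ.eq_var ?_
  rw [← hτ.induced_smul_var]
  apply h n
  rwa [hτ.induced_smul_var, hτ.vars_map]

theorem IsTranslation.isQuantaleTranslation (hτ : IsTranslation τ) :
    IsQuantaleTranslation (QuantaleHom.ofMonoidHom hτ.induced) where
  joinPrime A hA := by
    obtain ⟨σ, rfl⟩ := isCompletelyJoinPrime_set_iff.1 hA
    exact isCompletelyJoinPrime_set_iff.2 ⟨hτ.induced σ, Set.image_singleton⟩
  idempotent B _ hB A hA h := by
    obtain ⟨σ, rfl⟩ := isCompletelyJoinPrime_set_iff.1 hA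
    rw [QuantaleHom.ofMonoidHom_apply, Set.image_singleton] at h
    rw [← h, isIdempotentElem_singleton_iff] at hB
    exact isIdempotentElem_singleton_iff.2 (hτ.isIdempotentElem_of_induced hB)
  renamings r := by
    ext A
    change hτ.induced '' A = _ ↔ A = _
    constructor
    · intro h
      ext σ
      constructor
      · intro hσ
        obtain ⟨s, hs, hs'⟩ := h.le ⟨σ, hσ, rfl⟩
        exact ⟨s, hs, (hτ.induced_eq_rename_iff.1 hs'.symm).symm⟩
      · rintro ⟨s, hs, rfl⟩
        obtain ⟨σ, hσ, hs'⟩ := h.ge ⟨s, hs, rfl⟩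
        rwa [← hτ.induced_eq_rename_iff.1 hs']
    · rintro rfl
      rw [Set.image_image]
      exact Set.image_congr fun s _ => hτ.induced_eq_rename_iff.2 rfl

end Translation

/-! ### The language translation of a quantale translation -/

section Quantale

variable {L : PropLanguage.{u}} {L' : PropLanguage.{v}}
  {h : QuantaleHom (Set (Subst L)) (Set (Subst L'))}

theorem IsQuantaleTranslation.exists_monoidHom (hh : IsQuantaleTranslation h) :
    ∃ k : Subst L →* Subst L', ∀ σ, h {σ} = {k σ} := by
  have h1 : ∀ σ : Subst L, ∃ ρ : Subst L', h {σ} = {ρ} := fun σ =>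
    isCompletelyJoinPrime_set_iff.1 (hh.joinPrime _ (isCompletelyJoinPrime_set_iff.2 ⟨σ, rfl⟩))
  choose k hk using h1
  refine ⟨⟨⟨k, ?_⟩, ?_⟩, hk⟩
  · apply Set.singleton_injective
    rw [← hk, Set.singleton_one, Set.singleton_one]
    exact h.map_one'
  · intro σ ρ
    apply Set.singleton_injective
    change {k (σ * ρ)} = {k σ * k ρ}
    rw [← hk, ← Set.singleton_mul_singleton, ← Set.singleton_mul_singleton, ← hk, ← hk]
    exact h.map_mul' _ _

/-- The constant substitution with value `φ`. -/
def Subst.const (φ : Formula L) : Subst L := ofVars fun _ => φ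

/-- The action on formulas is thereby encoded in multiplication, which a monoid homomorphism
respects. -/
theorem Subst.mul_const (σ : Subst L) (φ : Formula L) : σ * const φ = const (σ • φ) :=
  mul_ofVars σ _

theorem Subst.const_var (n : ℕ) : const (Formula.var n : Formula L) = rename L fun _ => n := rfl

theorem Subst.const_smul_var (φ : Formula L) (n : ℕ) :
    const φ • (Formula.var n : Formula L) = φ := rfl

/-- The map on formulas determined by a map on substitutions, through the constant
substitutions. -/
def formulaMap (k : Subst L → Subst L') (φ : Formula L) : Formula L' :=
  k (Subst.const φ) • Formula.var 0

theorem formulaMap_smul (k : Subst L →* Subst L') (σ : Subst L) (φ : Formula L) :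
    formulaMap k (σ • φ) = k σ • formulaMap k φ := by
  rw [formulaMap, ← Subst.mul_const, map_mul, mul_smul]
  rfl

/-! ### Monoid homomorphisms that preserve and reflect renamings -/

section

variable {k : Subst L →* Subst L'}
  (hk : ∀ (σ : Subst L) (r : ℕ → ℕ), k σ = Subst.rename L' r ↔ σ = Subst.rename L r)
include hk

/-- The constant substitution at `x_n` is a renaming, so `k` preserves it; evaluating `k (σ * const
x_n)` at `x_0` gives both sides. This exhibits `k` as the homomorphism induced by `formulaMap k`. -/
theorem map_smul_var_eq_formulaMap (σ : Subst L) (n : ℕ) :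
    k σ • (Formula.var n : Formula L') = formulaMap k (σ • (Formula.var n : Formula L)) := by
  rw [formulaMap, ← Subst.mul_const, Subst.const_var, map_mul, (hk _ _).2 rfl, mul_smul,
    Subst.rename_smul_var]

theorem formulaMap_eq_var_iff {φ : Formula L} {n : ℕ} :
    formulaMap k φ = Formula.var n ↔ φ = Formula.var n := by
  constructor
  · intro h
    -- `k (const φ)` takes the value `formulaMap k φ` at every variable, so it is a constant
    -- renaming here and can be reflected.
    have h1 : k (Subst.const φ) = Subst.rename L' fun _ => n := by
      refine Subst.ext_vars fun m => ?_
      rw [map_smul_var_eq_formulaMap hk, Subst.const_smul_var, h, Subst.rename_smul_var]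
    have h2 := congrArg (fun σ => σ • (Formula.var 0 : Formula L)) ((hk _ _).1 h1)
    exact h2
  · rintro rfl
    rw [formulaMap, Subst.const_var, (hk _ _).2 rfl, Subst.rename_smul_var]

/-- If `x_m` does not occur in `φ`, a renaming that moves only `x_m` fixes `φ`. By equivariance it
fixes the image of `φ`, which therefore omits `x_m`. -/
theorem vars_formulaMap_subset (φ : Formula L) : (formulaMap k φ).vars ⊆ φ.vars := by
  intro m hm
  by_contra hmφ
  let r : ℕ → ℕ := fun n => if n = m then m + 1 else n
  have h1 : Subst.rename L r • φ = φ := by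
    rw [Subst.smul_eq_subst]
    conv_rhs => rw [← Formula.subst_var φ]
    refine Formula.subst_congr fun n hn => ?_
    have hnm : n ≠ m := fun h => hmφ (h ▸ hn)
    rw [Subst.rename_smul_var]
    simp only [r, if_neg hnm]
  have h2 := formulaMap_smul k (Subst.rename L r) φ
  rw [h1, (hk _ _).2 rfl, Subst.smul_eq_subst] at h2
  conv_lhs at h2 => rw [← Formula.subst_var (formulaMap k φ)]
  have h3 := Formula.subst_eq_subst_iff.1 h2 m hm
  rw [Subst.rename_smul_var] at h3
  simp [r] at h3

/-- Let `σ` send `x_m` to `φ` and fix the other variables. If the image of `φ` omitted `x_m`, then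
`k σ` would be idempotent, hence so would `σ`. As `x_m` occurs in `φ`, this forces `φ = x_m`, whose
image is `x_m` after all. -/
theorem vars_subset_formulaMap (hi : ∀ σ, IsIdempotentElem (k σ) → IsIdempotentElem σ)
    (φ : Formula L) : φ.vars ⊆ (formulaMap k φ).vars := by
  intro m hm
  by_contra hmφ
  let σ : Subst L := Subst.ofVars fun n => if n = m then φ else Formula.var n
  have hσm : σ • (Formula.var m : Formula L) = φ := by
    rw [Subst.ofVars_smul_var, if_pos rfl]
  have hσ : ∀ n, n ≠ m → σ • (Formula.var n : Formula L) = Formula.var n := fun n hn => by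
    rw [Subst.ofVars_smul_var, if_neg hn]
  have hkσ : ∀ n, n ≠ m → k σ • (Formula.var n : Formula L') = Formula.var n := fun n hn => by
    rw [map_smul_var_eq_formulaMap hk, hσ n hn, formulaMap_eq_var_iff hk]
  have h1 : IsIdempotentElem (k σ) := by
    rw [Subst.isIdempotentElem_iff]
    intro n l hl
    by_cases hn : n = m
    · subst hn
      rw [map_smul_var_eq_formulaMap hk, hσm] at hl
      exact hkσ l fun h => hmφ (h ▸ hl)
    · rw [hkσ n hn] at hl
      obtain rfl : l = n := hl
      exact hkσ l hn
  have h2 := Subst.isIdempotentElem_iff.1 (hi σ h1) m m (by rwa [hσm])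
  rw [hσm] at h2
  apply hmφ
  rw [(formulaMap_eq_var_iff hk).2 h2]
  rfl

theorem isTranslation_formulaMap (hi : ∀ σ, IsIdempotentElem (k σ) → IsIdempotentElem σ) :
    IsTranslation (formulaMap k) := by
  let χ : (f : L.Conn) → Formula L := fun f => Formula.app f fun i => Formula.var i
  have hχ : ∀ f, (formulaMap k (χ f)).vars = {n | n < L.arity f} := by
    intro f
    rw [Set.Subset.antisymm (vars_formulaMap_subset hk _) (vars_subset_formulaMap hk hi _)]
    ext n
    simp only [χ, Formula.vars, Set.mem_iUnion, Set.mem_singleton_iff, Set.mem_ofPred_eq]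
    constructor
    · rintro ⟨i, rfl⟩
      exact i.2
    · intro hn
      exact ⟨⟨n, hn⟩, rfl⟩
  refine ⟨fun f ψ => (formulaMap k (χ f)).subst
    (fun n => if hn : n < L.arity f then ψ ⟨n, hn⟩ else Formula.var n), ?_, ?_, ?_⟩
  · exact fun f => ⟨formulaMap k (χ f), hχ f, fun ψ => rfl⟩
  · intro n
    ext φ
    exact formulaMap_eq_var_iff hk
  · intro f φ
    let σ : Subst L := Subst.ofVars
      fun n => if hn : n < L.arity f then φ ⟨n, hn⟩ else Formula.var n
    -- Every formula with head `f` is an instance of `χ f`, so equivariance reduces its translation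
    -- to that of `χ f`.
    have h1 : Formula.app f φ = σ • χ f := by
      rw [Subst.smul_app]
      congr 1
      funext i
      rw [Subst.ofVars_smul_var, dif_pos i.2]
    rw [h1, formulaMap_smul k, Subst.smul_eq_subst]
    refine Formula.subst_congr fun n hn => ?_
    rw [hχ] at hn
    have hn' : n < L.arity f := hn
    rw [map_smul_var_eq_formulaMap hk, dif_pos hn', Subst.ofVars_smul_var, dif_pos hn']

end

theorem IsQuantaleTranslation.exists_isTranslation (hh : IsQuantaleTranslation h) :
    ∃ (τ : Formula L → Formula L') (hτ : IsTranslation τ), ∀ σ, h {σ} = {hτ.induced σ} := by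
  obtain ⟨k, hk⟩ := hh.exists_monoidHom
  have hr : ∀ (σ : Subst L) (r : ℕ → ℕ), k σ = Subst.rename L' r ↔ σ = Subst.rename L r := by
    intro σ r
    -- The condition on sets of renamings is needed only for singletons.
    have h1 : {σ} ∈ (h ⁻¹' {Subst.rename L' '' {r}} : Set (Set (Subst L))) ↔
        {σ} ∈ ({Subst.rename L '' {r}} : Set (Set (Subst L))) := by rw [hh.renamings]
    rwa [Set.mem_preimage, hk, Set.image_singleton, Set.image_singleton, Set.mem_singleton_iff,
      Set.mem_singleton_iff, Set.singleton_eq_singleton_iff, Set.singleton_eq_singleton_iff]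
      at h1
  have hi : ∀ σ, IsIdempotentElem (k σ) → IsIdempotentElem σ := fun σ hσ =>
    isIdempotentElem_singleton_iff.1 <| hh.idempotent {k σ}
      (isCompletelyJoinPrime_set_iff.2 ⟨_, rfl⟩) (isIdempotentElem_singleton_iff.2 hσ) {σ}
      (isCompletelyJoinPrime_set_iff.2 ⟨_, rfl⟩) (hk σ)
  refine ⟨formulaMap k, isTranslation_formulaMap hr hi, fun σ => ?_⟩
  rw [hk, Set.singleton_eq_singleton_iff]
  exact Subst.ext_vars fun n => map_smul_var_eq_formulaMap hr σ n

end Quantale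

/-! ### Generic sequents -/

namespace Sequent

variable {L : PropLanguage.{u}}

theorem formulas_ne_nil (s : Sequent L) : s.left ++ s.right ≠ [] := by
  intro h
  obtain ⟨h1, h2⟩ := List.append_eq_nil_iff.1 h
  exact s.nonempty (by rw [h1, h2]; rfl)

theorem smul_left (σ : Subst L) (s : Sequent L) :
    (σ • s).left = s.left.map (fun φ => σ • φ) := rfl

theorem smul_right (σ : Subst L) (s : Sequent L) :
    (σ • s).right = s.right.map (fun φ => σ • φ) := rfl

/-- The sequent `x_0, …, x_{m-1} ⇒ x_m, …, x_{m+n-1}` of the same type `(m, n)` as `s`. -/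
def generic (s : Sequent L) : Sequent L where
  left := (List.range s.left.length).map Formula.var
  right := (List.range s.right.length).map fun i => Formula.var (s.left.length + i)
  nonempty := by simpa only [List.length_map, List.length_range] using s.nonempty

theorem type_generic (s : Sequent L) : s.generic.type = s.type := by
  simp [generic, type]

theorem generic_smul (σ : Subst L) (s : Sequent L) : (σ • s).generic = s.generic := by
  apply ext' <;> simp [generic, smul_left, smul_right]

/-- The substitution that maps the variables of the generic sequent of the type of `s` to the
formulas of `s`, and all other variables to the first formula of `s`. -/
def instantiation (s : Sequent L) : Subst L :=
  Subst.ofVars fun n => (s.left ++ s.right).getD n ((s.left ++ s.right).head s.formulas_ne_nil)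

theorem instantiation_smul_generic (s : Sequent L) : s.instantiation • s.generic = s := by
  apply ext'
  · rw [smul_left]
    apply List.ext_getElem
    · simp [generic]
    · intro i h1 h2
      simp only [generic, List.getElem_map, List.getElem_range, instantiation,
        Subst.ofVars_smul_var]
      rw [List.getD_eq_getElem _ _ (by rw [List.length_append]; omega),
        List.getElem_append_left h2]
  · rw [smul_right]
    apply List.ext_getElem
    · simp [generic]
    · intro i h1 h2
      simp only [generic, List.getElem_map, List.getElem_range, instantiation,
        Subst.ofVars_smul_var]
      rw [List.getD_eq_getElem _ _ (by rw [List.length_append]; omega),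
        List.getElem_append_right (by omega)]
      simp

/-- The equality holds at all variables, including those outside the generic sequent: the default
value is itself a formula of `s`, so `σ` moves it too. A fixed default would break this; the
exclusion of type `(0, 0)` supplies the formula. -/
theorem instantiation_smul (σ : Subst L) (s : Sequent L) :
    (σ • s).instantiation = σ * s.instantiation := by
  rw [instantiation, instantiation, Subst.mul_ofVars]
  refine Subst.ext_vars fun n => ?_
  rw [Subst.ofVars_smul_var, Subst.ofVars_smul_var]
  have h : (σ • s).left ++ (σ • s).right = (s.left ++ s.right).map fun φ => σ • φ := by
    rw [smul_left, smul_right, List.map_append]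
  simp only [h, List.head_map]
  exact List.getD_map _ _ (fun φ => σ • φ)

end Sequent

namespace SequentSet

variable {L : PropLanguage.{u}} {S : SequentSet L}

/-- The generic sequent of the type of `s`, as a member of `S`. -/
def Elem.generic (s : S.Elem) : S.Elem :=
  ⟨s.1.generic, S.closed_type s.1 s.2 _ s.1.type_generic⟩

theorem Elem.generic_smul (σ : Subst L) (s : S.Elem) : (σ • s).generic = s.generic :=
  Subtype.ext (Sequent.generic_smul σ s.1)

theorem Elem.instantiation_smul_generic (s : S.Elem) : s.1.instantiation • s.generic = s :=
  Subtype.ext s.1.instantiation_smul_generic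

theorem Elem.instantiation_smul (σ : Subst L) (s : S.Elem) :
    (σ • s).1.instantiation = σ * s.1.instantiation :=
  Sequent.instantiation_smul σ s.1

end SequentSet

/-! ### Module homomorphisms lift to action-invariant maps -/

/-- Put `ι s = k (instantiation of s) • f (theory of the generic sequent)`. Acting by `σ` keeps the
generic sequent and multiplies the instantiation by `σ`, so `ι` is equivariant on the nose, before
closure. It lifts `f` because `f` preserves scalar multiplication and `s` is the instance of its
generic sequent. -/
theorem exists_actionInvariantVia_isLift {L : PropLanguage.{u}} {L' : PropLanguage.{v}}
    {S : DeductiveSystem L} {T : DeductiveSystem L'}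
    {h : QuantaleHom (Set (Subst L)) (Set (Subst L'))} {k : Subst L →* Subst L'}
    (hk : ∀ σ, h {σ} = {k σ})
    (f : QuantaleModuleHom (Set (Subst L)) S.TheoryModule (RestrictAlong h T.TheoryModule)) :
    ∃ ι : S.sequents.Elem → Set T.sequents.Elem,
      ActionInvariantVia k ι ∧ IsLift S.substInvariant T.substInvariant f ι := by
  let g : S.sequents.Elem → T.TheoryModule :=
    fun s => f.toFun ((S.conseq.nucleus S.substInvariant).close {s})
  refine ⟨fun s => k s.1.instantiation • (g s.generic).1, ?_, ?_⟩
  · intro σ s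
    change k (σ • s).1.instantiation • (g (σ • s).generic).1 = _
    rw [s.generic_smul, s.instantiation_smul, map_mul, mul_smul]
  · intro s
    have h1 := f.map_smul' {s.1.instantiation}
      ((S.conseq.nucleus S.substInvariant).close {s.generic})
    rw [ModuleNucleus.smul_def, ModuleNucleus.close_smul_close, Set.singleton_smul_singleton,
      s.instantiation_smul_generic] at h1
    rw [h1]
    change h {s.1.instantiation} • g s.generic = _
    rw [hk, ModuleNucleus.smul_def, Set.singleton_smul]

end DedSys

theorem theorem7p1 {L : DedSys.PropLanguage.{u}} {L' : DedSys.PropLanguage.{v}}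
    (S : DedSys.DeductiveSystem L) (T : DedSys.DeductiveSystem L') :
    (S.InterpretableIn T ↔
      ∃ h : DedSys.QuantaleHom (Set (DedSys.Subst L)) (Set (DedSys.Subst L')),
        DedSys.IsQuantaleTranslation h ∧
        Nonempty (DedSys.QuantaleModuleHom (Set (DedSys.Subst L)) S.TheoryModule
          (DedSys.RestrictAlong h T.TheoryModule))) ∧
    (S.RepresentableIn T ↔
      ∃ h : DedSys.QuantaleHom (Set (DedSys.Subst L)) (Set (DedSys.Subst L')),
        DedSys.IsQuantaleTranslation h ∧
        ∃ f : DedSys.QuantaleModuleHom (Set (DedSys.Subst L)) S.TheoryModule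
          (DedSys.RestrictAlong h T.TheoryModule), Function.Injective f.toFun) := by
  refine ⟨⟨?_, ?_⟩, ⟨?_, ?_⟩⟩
  · rintro ⟨τ, hτ, ι, hι⟩
    exact ⟨_, hτ.isQuantaleTranslation, ⟨hι.moduleHom S.substInvariant T.substInvariant⟩⟩
  · rintro ⟨h, hh, ⟨f⟩⟩
    obtain ⟨τ, hτ, hk⟩ := hh.exists_isTranslation
    obtain ⟨ι, hι, hf⟩ := DedSys.exists_actionInvariantVia_isLift hk f
    exact ⟨τ, hτ, ι, hι, fun X x hx => hf.entailsSet hx⟩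
  · rintro ⟨τ, hτ, ι, hι⟩
    exact ⟨_, hτ.isQuantaleTranslation, _,
      hι.moduleHom_injective S.substInvariant T.substInvariant⟩
  · rintro ⟨h, hh, f, hinj⟩
    obtain ⟨τ, hτ, hk⟩ := hh.exists_isTranslation
    obtain ⟨ι, hι, hf⟩ := DedSys.exists_actionInvariantVia_isLift hk f
    exact ⟨τ, hτ, ι, hι, fun X x => ⟨fun hx => hf.entailsSet hx,
      fun hx => hf.entails_of_injective hinj hx⟩⟩
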